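/- Let $\Sigma$ and $B$ be endofunctors on the category of sets and functions. Assume that for every set $X$ the functor $\Sigma(-)+X$ has an initial algebra, with carrier $\Sigma^*X$ and structure maps $\psi_X:\Sigma\Sigma^*X\to\Sigma^*X$ and $\eta_X:X\to\Sigma^*X$, and that for every set $X$ the functor $B(-)\times X$ has a final coalgebra, with carrier $B^\infty X$ and structure maps $\theta_X:B^\infty X\to BB^\infty X$ and $\epsilon_X:B^\infty X\to X$. Let $(\Sigma^*,\eta,\mu)$ be the resulting free monad over $\Sigma$ (so $\mu_X:\Sigma^*\Sigma^*X\to\Sigma^*X$ is the unique $\Sigma$-algebra morphism with $\mu_X\circ\eta_{\Sigma^*X}=\mathrm{id}$), let $(B^\infty,\epsilon,\delta)$ be the resulting cofree comonad over $B$ (so $\delta_X:B^\infty X\to B^\infty B^\infty X$ is the unique $B$-coalgebra morphism with $\epsilon_{B^\infty X}\circ\delta_X=\mathrm{id}$), and put $\iota=\psi\circ\Sigma\eta:\Sigma\Rightarrow\Sigma^*$ and $\pi=B\epsilon\circ\theta:B^\infty\Rightarrow B$. A distributive law is a natural transformation $\lambda:\Sigma^*B^\infty\Rightarrow B^\infty\Sigma^*$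 such that $\lambda\circ\eta B^\infty=B^\infty\eta$, $\ \epsilon\Sigma^*\circ\lambda=\Sigma^*\epsilon$, $\ \lambda\circ\mu B^\infty=B^\infty\mu\circ\lambda\Sigma^*\circ\Sigma^*\lambda$ and $\delta\Sigma^*\circ\lambda=B^\infty\lambda\circ\lambda B^\infty\circ\Sigma^*\delta$. It extends a natural transformation (biGSOS law) $\rho:\Sigma B^\infty\Rightarrow B\Sigma^*$ if $\pi\Sigma^*\circ\lambda\circ\iota B^\infty=\rho$. 1. For every GSOS law, i.e. natural transformation $\rho':\Sigma(\mathrm{Id}\times B)\Rightarrow B\Sigma^*$, there is a unique distributive law $\lambda:\Sigma^*B^\infty\Rightarrow B^\infty\Sigma^*$ that extends the associated biGSOS law $\rho'\circ\Sigma\langle\epsilon,\pi\rangle:\Sigma B^\infty\Rightarrow B\Sigma^*$. 2. For every coGSOS law, i.e. natural transformation $\rho'':\Sigma B^\infty\Rightarrow B(\mathrm{Id}+\Sigma)$, there is a unique distributive law $\lambda:\Sigma^*B^\infty\Rightarrow B^\infty\Sigma^*$ that extends the associated biGSOS law $B[\eta,\iota]\circ\rho'':\Sigma B^\infty\Rightarrow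 B\Sigma^*$. -/

import Mathlib

open CategoryTheory CategoryTheory.Limits

universe w

namespace Klin

universe v u

variable {C : Type u} [Category.{v} C]

/-- The functor `Y ↦ S Y + X`. -/
noncomputable abbrev sumConst [HasBinaryCoproducts C] (S : C ⥤ C) (X : C) : C ⥤ C where
  obj Y := S.obj Y ⨿ X
  map f := coprod.map (S.map f) (𝟙 X)

/-- The functor `Y ↦ B Y × X`. -/
noncomputable abbrev prodConst [HasBinaryProducts C] (B : C ⥤ C) (X : C) : C ⥤ C where
  obj Y := B.obj Y ⨯ X
  map f := prod.map (B.map f) (𝟙 X)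

/-- `B̃ = Id × B`. -/
noncomputable def idProd [HasBinaryProducts C] (B : C ⥤ C) : C ⥤ C where
  obj X := X ⨯ B.obj X
  map f := prod.map f (B.map f)

/-- `S̄ = Id + S`. -/
noncomputable def idSum [HasBinaryCoproducts C] (S : C ⥤ C) : C ⥤ C where
  obj X := X ⨿ S.obj X
  map f := coprod.map f (S.map f)

/-- A choice, for every `X`, of an initial algebra for the functor `S(-) + X`. -/
structure FreeAlgebras [HasBinaryCoproducts C] (S : C ⥤ C) where
  alg : ∀ X : C, Endofunctor.Algebra (sumConst S X)
  isInitial : ∀ X : C, IsInitial (alg X)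

/-- A choice, for every `X`, of a final coalgebra for the functor `B(-) × X`. -/
structure CofreeCoalgebras [HasBinaryProducts C] (B : C ⥤ C) where
  coalg : ∀ X : C, Endofunctor.Coalgebra (prodConst B X)
  isTerminal : ∀ X : C, IsTerminal (coalg X)

namespace FreeAlgebras

variable [HasBinaryCoproducts C] {S : C ⥤ C} (F : FreeAlgebras S)

/-- The carrier `S* X`. -/
abbrev obj (X : C) : C := (F.alg X).a

/-- `ψ_X : S (S* X) ⟶ S* X`. -/
noncomputable def psi (X : C) : S.obj (F.obj X) ⟶ F.obj X :=
  (coprod.inl : S.obj (F.obj X) ⟶ S.obj (F.obj X) ⨿ X) ≫ (F.alg X).str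

/-- `η_X : X ⟶ S* X`. -/
noncomputable def eta (X : C) : X ⟶ F.obj X :=
  (coprod.inr : X ⟶ S.obj (F.obj X) ⨿ X) ≫ (F.alg X).str

/-- The algebra morphism out of the initial `(S(-) + X)`-algebra given by an `S`-algebra structure
`g` on `Y` and a morphism `f : X ⟶ Y`. -/
noncomputable def fold {X Y : C} (g : S.obj Y ⟶ Y) (f : X ⟶ Y) : F.obj X ⟶ Y :=
  ((F.isInitial X).to
    ({ a := Y, str := coprod.desc g f } : Endofunctor.Algebra (sumConst S X))).f

theorem psi_fold {X Y : C} (g : S.obj Y ⟶ Y) (f : X ⟶ Y) :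
    F.psi X ≫ F.fold g f = S.map (F.fold g f) ≫ g := by
  have h := ((F.isInitial X).to
    ({ a := Y, str := coprod.desc g f } : Endofunctor.Algebra (sumConst S X))).h
  have h' := congrArg (fun k => (coprod.inl : S.obj (F.obj X) ⟶ S.obj (F.obj X) ⨿ X) ≫ k) h
  dsimp [sumConst] at h'
  rw [coprod.inl_map_assoc, coprod.inl_desc] at h'
  simp only [psi, Category.assoc]
  exact h'.symm

theorem eta_fold {X Y : C} (g : S.obj Y ⟶ Y) (f : X ⟶ Y) :
    F.eta X ≫ F.fold g f = f := by
  have h := ((F.isInitial X).to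
    ({ a := Y, str := coprod.desc g f } : Endofunctor.Algebra (sumConst S X))).h
  have h' := congrArg (fun k => (coprod.inr : X ⟶ S.obj (F.obj X) ⨿ X) ≫ k) h
  dsimp [sumConst] at h'
  rw [coprod.inr_map_assoc, coprod.inr_desc, Category.id_comp] at h'
  simp only [eta, Category.assoc]
  exact h'.symm

theorem fold_unique {X Y : C} (g : S.obj Y ⟶ Y) (f : X ⟶ Y) (k : F.obj X ⟶ Y)
    (h₁ : F.psi X ≫ k = S.map k ≫ g) (h₂ : F.eta X ≫ k = f) : k = F.fold g f := by
  let K : F.alg X ⟶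
      ({ a := Y, str := coprod.desc g f } : Endofunctor.Algebra (sumConst S X)) :=
    { f := k
      h := by
        dsimp [sumConst]
        apply coprod.hom_ext
        · rw [coprod.inl_map_assoc, coprod.inl_desc, ← h₁, psi, Category.assoc]
        · rw [coprod.inr_map_assoc, coprod.inr_desc, Category.id_comp, ← h₂, eta, Category.assoc] }
  exact congrArg Endofunctor.Algebra.Hom.f ((F.isInitial X).hom_ext K _)

theorem hom_ext {X Y : C} (g : S.obj Y ⟶ Y) {k l : F.obj X ⟶ Y}
    (hk : F.psi X ≫ k = S.map k ≫ g) (hl : F.psi X ≫ l = S.map l ≫ g)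
    (h : F.eta X ≫ k = F.eta X ≫ l) : k = l :=
  (F.fold_unique g _ k hk h).trans (F.fold_unique g _ l hl rfl).symm

/-- The functor `S*`, defined on morphisms by initiality. -/
noncomputable def functor : C ⥤ C where
  obj := F.obj
  map {X Y} f := F.fold (F.psi Y) (f ≫ F.eta Y)
  map_id X := (F.fold_unique _ _ _ (by simp) (by simp)).symm
  map_comp {X Y Z} f g := by
    refine (F.fold_unique _ _ _ ?_ ?_).symm
    · rw [← Category.assoc, psi_fold, Category.assoc, psi_fold, ← Category.assoc, ← S.map_comp]
    · rw [← Category.assoc, eta_fold, Category.assoc, eta_fold, Category.assoc]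

/-- The free monad `S*` over `S`; its multiplication `μ_X` is the unique `S`-algebra morphism
extending the identity of `S* X`. -/
noncomputable def monad : Monad C where
  toFunctor := F.functor
  η := { app := F.eta, naturality := fun _ _ f => (F.eta_fold _ _).symm }
  μ :=
    { app := fun X => F.fold (F.psi X) (𝟙 (F.obj X))
      naturality := fun X Y f => by
        refine F.hom_ext (X := F.obj X) (F.psi Y) ?_ ?_ ?_
        · dsimp [functor]
          rw [← Category.assoc, psi_fold, Category.assoc, psi_fold, ← Category.assoc, ← S.map_comp]
        · dsimp [functor]
          rw [← Category.assoc, psi_fold, Category.assoc, psi_fold, ← Category.assoc, ← S.map_comp]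
        · dsimp [functor]
          rw [← Category.assoc, eta_fold, Category.assoc, eta_fold, ← Category.assoc, eta_fold,
            Category.comp_id, Category.id_comp] }
  assoc X := by
    refine F.hom_ext (X := F.obj (F.obj X)) (F.psi X) ?_ ?_ ?_
    · dsimp [functor]
      rw [← Category.assoc, psi_fold, Category.assoc, psi_fold, ← Category.assoc, ← S.map_comp]
    · dsimp [functor]
      rw [← Category.assoc, psi_fold, Category.assoc, psi_fold, ← Category.assoc, ← S.map_comp]
    · dsimp [functor]
      rw [← Category.assoc, eta_fold, Category.assoc, eta_fold, ← Category.assoc, eta_fold,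
        Category.comp_id, Category.id_comp]
  left_unit X := F.eta_fold _ _
  right_unit X := by
    refine F.hom_ext (X := X) (F.psi X) ?_ ?_ ?_
    · dsimp [functor]
      rw [← Category.assoc, psi_fold, Category.assoc, psi_fold, ← Category.assoc, ← S.map_comp]
    · dsimp [functor]
      simp
    · dsimp [functor]
      rw [← Category.assoc, eta_fold, Category.assoc, eta_fold]

/-- `ι = ψ ∘ S η : S ⟹ S*`. -/
noncomputable def iota : S ⟶ F.monad.toFunctor where
  app X := S.map (F.eta X) ≫ F.psi X
  naturality X Y f := by
    change S.map f ≫ S.map (F.eta Y) ≫ F.psi Y =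
      (S.map (F.eta X) ≫ F.psi X) ≫ F.fold (F.psi Y) (f ≫ F.eta Y)
    rw [Category.assoc, psi_fold, ← Category.assoc, ← Category.assoc, ← S.map_comp, ← S.map_comp,
      eta_fold]

end FreeAlgebras

namespace CofreeCoalgebras

variable [HasBinaryProducts C] {B : C ⥤ C} (G : CofreeCoalgebras B)

/-- The carrier `B^∞ X`. -/
abbrev obj (X : C) : C := (G.coalg X).V

/-- `θ_X : B^∞ X ⟶ B (B^∞ X)`. -/
noncomputable def theta (X : C) : G.obj X ⟶ B.obj (G.obj X) :=
  (G.coalg X).str ≫ (prod.fst : B.obj (G.obj X) ⨯ X ⟶ B.obj (G.obj X))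

/-- `ε_X : B^∞ X ⟶ X`. -/
noncomputable def eps (X : C) : G.obj X ⟶ X :=
  (G.coalg X).str ≫ (prod.snd : B.obj (G.obj X) ⨯ X ⟶ X)

/-- The coalgebra morphism into the final `(B(-) × X)`-coalgebra given by a `B`-coalgebra structure
`g` on `Y` and a morphism `f : Y ⟶ X`. -/
noncomputable def unfold {X Y : C} (g : Y ⟶ B.obj Y) (f : Y ⟶ X) : Y ⟶ G.obj X :=
  ((G.isTerminal X).from
    ({ V := Y, str := prod.lift g f } : Endofunctor.Coalgebra (prodConst B X))).f

theorem unfold_theta {X Y : C} (g : Y ⟶ B.obj Y) (f : Y ⟶ X) :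
    G.unfold g f ≫ G.theta X = g ≫ B.map (G.unfold g f) := by
  have h := ((G.isTerminal X).from
    ({ V := Y, str := prod.lift g f } : Endofunctor.Coalgebra (prodConst B X))).h
  have h' := congrArg (fun k => k ≫ (prod.fst : B.obj (G.obj X) ⨯ X ⟶ B.obj (G.obj X))) h
  dsimp [prodConst] at h'
  rw [Category.assoc, prod.map_fst, prod.lift_fst_assoc, Category.assoc] at h'
  exact h'.symm

theorem unfold_eps {X Y : C} (g : Y ⟶ B.obj Y) (f : Y ⟶ X) :
    G.unfold g f ≫ G.eps X = f := by
  have h := ((G.isTerminal X).from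
    ({ V := Y, str := prod.lift g f } : Endofunctor.Coalgebra (prodConst B X))).h
  have h' := congrArg (fun k => k ≫ (prod.snd : B.obj (G.obj X) ⨯ X ⟶ X)) h
  dsimp [prodConst] at h'
  rw [Category.assoc, prod.map_snd, prod.lift_snd_assoc, Category.comp_id, Category.assoc] at h'
  exact h'.symm

theorem unfold_unique {X Y : C} (g : Y ⟶ B.obj Y) (f : Y ⟶ X) (k : Y ⟶ G.obj X)
    (h₁ : k ≫ G.theta X = g ≫ B.map k) (h₂ : k ≫ G.eps X = f) : k = G.unfold g f := by
  let K : ({ V := Y, str := prod.lift g f } : Endofunctor.Coalgebra (prodConst B X)) ⟶ G.coalg X :=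
    { f := k
      h := by
        dsimp [prodConst]
        apply Limits.prod.hom_ext
        · rw [Category.assoc, prod.map_fst, prod.lift_fst_assoc, ← h₁, theta, Category.assoc]
        · rw [Category.assoc, prod.map_snd, prod.lift_snd_assoc, Category.comp_id, ← h₂, eps,
            Category.assoc] }
  exact congrArg Endofunctor.Coalgebra.Hom.f ((G.isTerminal X).hom_ext K _)

theorem hom_ext {X Y : C} (g : Y ⟶ B.obj Y) {k l : Y ⟶ G.obj X}
    (hk : k ≫ G.theta X = g ≫ B.map k) (hl : l ≫ G.theta X = g ≫ B.map l)
    (h : k ≫ G.eps X = l ≫ G.eps X) : k = l :=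
  (G.unfold_unique g _ k hk h).trans (G.unfold_unique g _ l hl rfl).symm

/-- The functor `B^∞`, defined on morphisms by finality. -/
noncomputable def functor : C ⥤ C where
  obj := G.obj
  map {X Y} f := G.unfold (G.theta X) (G.eps X ≫ f)
  map_id X := (G.unfold_unique _ _ _ (by simp) (by simp)).symm
  map_comp {X Y Z} f g := by
    refine (G.unfold_unique _ _ _ ?_ ?_).symm
    · rw [Category.assoc, unfold_theta, ← Category.assoc, unfold_theta, Category.assoc,
        ← B.map_comp]
    · rw [Category.assoc, unfold_eps, ← Category.assoc, unfold_eps, Category.assoc]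

/-- The cofree comonad `B^∞` over `B`; its comultiplication `δ_X` is the unique `B`-coalgebra
morphism whose composite with `ε` is the identity of `B^∞ X`. -/
noncomputable def comonad : Comonad C where
  toFunctor := G.functor
  ε := { app := G.eps, naturality := fun _ _ f => G.unfold_eps _ _ }
  δ :=
    { app := fun X => G.unfold (G.theta X) (𝟙 (G.obj X))
      naturality := fun X Y f => by
        refine G.hom_ext (X := G.obj Y) (G.theta X) ?_ ?_ ?_
        · dsimp [functor]
          rw [Category.assoc, unfold_theta, ← Category.assoc, unfold_theta, Category.assoc,
            ← B.map_comp]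
        · dsimp [functor]
          rw [Category.assoc, unfold_theta, ← Category.assoc, unfold_theta, Category.assoc,
            ← B.map_comp]
        · dsimp [functor]
          rw [Category.assoc, unfold_eps, Category.assoc, unfold_eps, ← Category.assoc,
            unfold_eps, Category.comp_id, Category.id_comp] }
  coassoc X := by
    refine G.hom_ext (X := G.obj (G.obj X)) (G.theta X) ?_ ?_ ?_
    · dsimp [functor]
      rw [Category.assoc, unfold_theta, ← Category.assoc, unfold_theta, Category.assoc,
        ← B.map_comp]
    · dsimp [functor]
      rw [Category.assoc, unfold_theta, ← Category.assoc, unfold_theta, Category.assoc,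
        ← B.map_comp]
    · dsimp [functor]
      rw [Category.assoc, unfold_eps, Category.assoc, unfold_eps, ← Category.assoc,
        unfold_eps, Category.comp_id, Category.id_comp]
  left_counit X := G.unfold_eps _ _
  right_counit X := by
    refine G.hom_ext (X := X) (G.theta X) ?_ ?_ ?_
    · dsimp [functor]
      rw [Category.assoc, unfold_theta, ← Category.assoc, unfold_theta, Category.assoc,
        ← B.map_comp]
    · dsimp [functor]
      simp
    · dsimp [functor]
      rw [Category.assoc, unfold_eps, ← Category.assoc, unfold_eps]

/-- `π = B ε ∘ θ : B^∞ ⟹ B`. -/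
noncomputable def pi : G.comonad.toFunctor ⟶ B where
  app X := G.theta X ≫ B.map (G.eps X)
  naturality X Y f := by
    change G.unfold (G.theta X) (G.eps X ≫ f) ≫ G.theta Y ≫ B.map (G.eps Y) =
      (G.theta X ≫ B.map (G.eps X)) ≫ B.map f
    rw [← Category.assoc, unfold_theta, Category.assoc, Category.assoc, ← B.map_comp,
      ← B.map_comp, unfold_eps]

end CofreeCoalgebras

/-- A distributive law of a monad `T` over a comonad `D`: a natural transformation `T D ⟹ D T`
(here `F ⋙ G` is `G` after `F`) compatible with unit, counit, multiplication, comultiplication. -/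
@[ext]
structure DistributiveLaw (T : Monad C) (D : Comonad C) where
  lam : D.toFunctor ⋙ T.toFunctor ⟶ T.toFunctor ⋙ D.toFunctor
  unit : ∀ X, T.η.app (D.obj X) ≫ lam.app X = D.map (T.η.app X)
  counit : ∀ X, lam.app X ≫ D.ε.app (T.obj X) = T.map (D.ε.app X)
  mul : ∀ X, T.μ.app (D.obj X) ≫ lam.app X =
    T.map (lam.app X) ≫ lam.app (T.obj X) ≫ D.map (T.μ.app X)
  comul : ∀ X, lam.app X ≫ D.δ.app (T.obj X) =
    T.map (D.δ.app X) ≫ lam.app (D.obj X) ≫ D.map (lam.app X)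

variable {S B : C ⥤ C}

/-- A GSOS law `S (Id × B) ⟹ B S*`. -/
abbrev GSOSLaw [HasBinaryCoproducts C] [HasBinaryProducts C] (F : FreeAlgebras S)
    (B : C ⥤ C) :=
  idProd B ⋙ S ⟶ F.monad.toFunctor ⋙ B

/-- A coGSOS law `S B^∞ ⟹ B (Id + S)`. -/
abbrev CoGSOSLaw [HasBinaryCoproducts C] [HasBinaryProducts C] (S : C ⥤ C)
    (G : CofreeCoalgebras B) :=
  G.comonad.toFunctor ⋙ S ⟶ idSum S ⋙ B

/-- A biGSOS law `S B^∞ ⟹ B S*`. -/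
abbrev BiGSOSLaw [HasBinaryCoproducts C] [HasBinaryProducts C] (F : FreeAlgebras S)
    (G : CofreeCoalgebras B) :=
  G.comonad.toFunctor ⋙ S ⟶ F.monad.toFunctor ⋙ B

/-- `⟨ε, π⟩ : B^∞ ⟹ Id × B`. -/
noncomputable def epsPi [HasBinaryProducts C] (G : CofreeCoalgebras B) :
    G.comonad.toFunctor ⟶ idProd B where
  app X := prod.lift (G.comonad.ε.app X) (G.pi.app X)
  naturality X Y f := by
    have h₁ := G.comonad.ε.naturality f
    have h₂ := G.pi.naturality f
    dsimp [idProd] at h₁ ⊢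
    rw [prod.comp_lift, prod.lift_map, h₁, h₂]

/-- `[η, ι] : Id + S ⟹ S*`. -/
noncomputable def etaIota [HasBinaryCoproducts C] (F : FreeAlgebras S) :
    idSum S ⟶ F.monad.toFunctor where
  app X := coprod.desc (F.monad.η.app X) (F.iota.app X)
  naturality X Y f := by
    have h₁ := F.monad.η.naturality f
    have h₂ := F.iota.naturality f
    dsimp [idSum] at h₁ ⊢
    rw [coprod.desc_comp, coprod.map_desc, h₁, h₂]

section

variable [HasBinaryCoproducts C] [HasBinaryProducts C]

/-- The biGSOS law `ρ ∘ S ⟨ε, π⟩` associated with a GSOS law `ρ`. -/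
noncomputable def GSOSLaw.toBiGSOS {F : FreeAlgebras S} (ρ : GSOSLaw F B)
    (G : CofreeCoalgebras B) : BiGSOSLaw F G :=
  Functor.whiskerRight (epsPi G) S ≫ ρ

/-- The biGSOS law `B [η, ι] ∘ ρ` associated with a coGSOS law `ρ`. -/
noncomputable def CoGSOSLaw.toBiGSOS {G : CofreeCoalgebras B} (ρ : CoGSOSLaw S G)
    (F : FreeAlgebras S) : BiGSOSLaw F G :=
  ρ ≫ Functor.whiskerRight (etaIota F) B

/-- `l` extends the biGSOS law `ρ`: `π S* ∘ l ∘ ι B^∞ = ρ`. -/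
def DistributiveLaw.Extends {F : FreeAlgebras S} {G : CofreeCoalgebras B}
    (l : DistributiveLaw F.monad G.comonad) (ρ : BiGSOSLaw F G) : Prop :=
  Functor.whiskerLeft G.comonad.toFunctor F.iota ≫ l.lam ≫
    Functor.whiskerLeft F.monad.toFunctor G.pi = ρ

end

end Klin

/-! A transformation `S* B^∞ ⟹ B^∞ S*` maps out of a free algebra and into a cofree coalgebra, so it
can be produced by recursion or by corecursion. Corecursion from any `β : T B^∞ ⟹ B T` gives a `λ`
that satisfies the counit and comultiplication axioms for free, and the other two axioms reduce to
compatibility of `β` with `η` and `μ` (`CofreeCoalgebras.liftLaw`). Dually, recursion from any `κ :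
S D ⟹ D S*` gives the unit and multiplication axioms, and the rest reduces to compatibility of `κ`
with `ε` and `δ` (`FreeAlgebras.liftLaw`).

A GSOS law inspects its arguments only through `⟨ε, π⟩`. The composite `⟨ε, π⟩ ∘ λ` therefore
satisfies a recursion that does not mention the rest of `λ`. Its unique solution is
`GSOSLaw.pairing`. The `B`-component of the solution serves as `β`, and `mu_pairing`, proved by
induction on terms, supplies compatibility with `μ`. For uniqueness, every law extending `ρ` solves
the same recursion (`lam_epsPi_of_extends`), and a distributive law over a cofree comonad is
determined by `π ∘ λ` (`DistributiveLaw.ext_of_pi`).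

The coGSOS case is dual: `λ ∘ [η, ι]` satisfies a closed corecursion with solution
`CoGSOSLaw.copairing`. Its restriction to `S B^∞` serves as `κ`, and `λ ∘ ι` determines `λ`
(`DistributiveLaw.ext_of_iota`). Only binary products and coproducts are used, so the argument runs
in an arbitrary category `C` that has them. -/

namespace Klin

universe v u

variable {C : Type u} [Category.{v} C]

/-! ### Coinductive extension over a cofree comonad -/

/-- `k` is a morphism of `B`-coalgebras from `g` to `h`. -/
def IsCoalgHom (B : C ⥤ C) {X Y : C} (g : X ⟶ B.obj X) (h : Y ⟶ B.obj Y) (k : X ⟶ Y) : Prop :=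
  k ≫ h = g ≫ B.map k

theorem IsCoalgHom.comp {B : C ⥤ C} {X Y Z : C} {g : X ⟶ B.obj X} {h : Y ⟶ B.obj Y}
    {i : Z ⟶ B.obj Z} {k : X ⟶ Y} {l : Y ⟶ Z} (hk : IsCoalgHom B g h k)
    (hl : IsCoalgHom B h i l) : IsCoalgHom B g i (k ≫ l) := by
  unfold IsCoalgHom at *
  rw [Category.assoc, hl, ← Category.assoc, hk, Category.assoc, B.map_comp]

namespace CofreeCoalgebras

variable [HasBinaryProducts C] {B : C ⥤ C} (G : CofreeCoalgebras B)

/-- `θ` as a natural transformation `B^∞ ⟹ B B^∞`. -/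
noncomputable def thetaNat : G.comonad.toFunctor ⟶ G.comonad.toFunctor ⋙ B where
  app X := G.theta X
  naturality _ _ _ := G.unfold_theta _ _

theorem isCoalgHom_map {X Y : C} (f : X ⟶ Y) :
    IsCoalgHom B (G.thetaNat.app X) (G.thetaNat.app Y) (G.comonad.map f) :=
  G.thetaNat.naturality f

theorem isCoalgHom_delta (X : C) :
    IsCoalgHom B (G.thetaNat.app X) (G.thetaNat.app (G.comonad.obj X)) (G.comonad.δ.app X) :=
  G.unfold_theta _ _

theorem thetaNat_eps (X : C) :
    G.thetaNat.app X ≫ B.map (G.comonad.ε.app X) = G.pi.app X := rfl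

/-- As `δ` commutes with `θ`, the composite reduces to `θ` followed by `B (ε ∘ δ) = id`. This
recovers `θ` from `π`, so the comultiplication axiom can be read as a statement about coalgebra
morphisms. -/
theorem delta_pi (X : C) :
    G.comonad.δ.app X ≫ G.pi.app (G.comonad.obj X) = G.thetaNat.app X := by
  have h : G.comonad.δ.app X ≫ G.thetaNat.app (G.comonad.obj X) =
    G.thetaNat.app X ≫ B.map (G.comonad.δ.app X) := G.isCoalgHom_delta X
  have h' := G.comonad.left_counit X
  rw [← thetaNat_eps, ← Category.assoc, h, Category.assoc, ← B.map_comp, h', B.map_id]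
  exact Category.comp_id _

/-- The coalgebra morphism into the cofree coalgebra on `X` induced by `f : Y ⟶ X`. -/
noncomputable def corec {X Y : C} (g : Y ⟶ B.obj Y) (f : Y ⟶ X) : Y ⟶ G.comonad.obj X :=
  G.unfold g f

theorem isCoalgHom_corec {X Y : C} (g : Y ⟶ B.obj Y) (f : Y ⟶ X) :
    IsCoalgHom B g (G.thetaNat.app X) (G.corec g f) :=
  G.unfold_theta g f

theorem corec_eps {X Y : C} (g : Y ⟶ B.obj Y) (f : Y ⟶ X) :
    G.corec g f ≫ G.comonad.ε.app X = f :=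
  G.unfold_eps g f

theorem ext_of_isCoalgHom {X Y : C} {g : Y ⟶ B.obj Y} {k l : Y ⟶ G.comonad.obj X}
    (hk : IsCoalgHom B g (G.thetaNat.app X) k) (hl : IsCoalgHom B g (G.thetaNat.app X) l)
    (h : k ≫ G.comonad.ε.app X = l ≫ G.comonad.ε.app X) : k = l :=
  G.hom_ext g hk hl h

variable {T : Monad C} (β : G.comonad.toFunctor ⋙ T.toFunctor ⟶ T.toFunctor ⋙ B)

/-- The coalgebra structure on `T B^∞ X` induced by `β : T B^∞ ⟹ B T`. -/
noncomputable def liftStr (X : C) :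
    T.obj (G.comonad.obj X) ⟶ B.obj (T.obj (G.comonad.obj X)) :=
  T.map (G.comonad.δ.app X) ≫ β.app (G.comonad.obj X)

theorem isCoalgHom_liftStr_map {X Y : C} (f : X ⟶ Y) :
    IsCoalgHom B (G.liftStr β X) (G.liftStr β Y) (T.map (G.comonad.map f)) := by
  have h₁ : T.map (G.comonad.map (G.comonad.map f)) ≫ β.app (G.comonad.obj Y) =
    β.app (G.comonad.obj X) ≫ B.map (T.map (G.comonad.map f)) := β.naturality _
  have h₂ : G.comonad.map f ≫ G.comonad.δ.app Y =
    G.comonad.δ.app X ≫ G.comonad.map (G.comonad.map f) := G.comonad.δ.naturality f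
  rw [IsCoalgHom, liftStr, liftStr, ← Category.assoc, ← T.map_comp, h₂, T.map_comp,
    Category.assoc, h₁, Category.assoc]

theorem isCoalgHom_liftStr_delta (X : C) :
    IsCoalgHom B (G.liftStr β X) (G.liftStr β (G.comonad.obj X))
      (T.map (G.comonad.δ.app X)) := by
  have h₁ : T.map (G.comonad.map (G.comonad.δ.app X)) ≫
      β.app (G.comonad.obj (G.comonad.obj X)) =
    β.app (G.comonad.obj X) ≫ B.map (T.map (G.comonad.δ.app X)) := β.naturality _
  rw [IsCoalgHom, liftStr, liftStr, ← Category.assoc, ← T.map_comp, ← G.comonad.coassoc,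
    T.map_comp, Category.assoc, h₁, Category.assoc]

/-- The transformation `T B^∞ ⟹ B^∞ T` coinductively extending `β : T B^∞ ⟹ B T`. -/
noncomputable def lift :
    G.comonad.toFunctor ⋙ T.toFunctor ⟶ T.toFunctor ⋙ G.comonad.toFunctor where
  app X := G.corec (G.liftStr β X) (T.map (G.comonad.ε.app X))
  naturality X Y f := by
    refine G.ext_of_isCoalgHom ((G.isCoalgHom_liftStr_map β f).comp (G.isCoalgHom_corec _ _))
      ((G.isCoalgHom_corec _ _).comp (G.isCoalgHom_map (T.map f))) ?_
    have h₁ : G.comonad.map (T.map f) ≫ G.comonad.ε.app (T.obj Y) =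
      G.comonad.ε.app (T.obj X) ≫ T.map f := G.comonad.ε.naturality _
    have h₂ : G.comonad.map f ≫ G.comonad.ε.app Y = G.comonad.ε.app X ≫ f :=
      G.comonad.ε.naturality f
    dsimp only [Functor.comp_map, Functor.comp_obj]
    rw [Category.assoc, corec_eps, Category.assoc, h₁, ← T.map_comp, h₂, T.map_comp,
      ← Category.assoc, corec_eps]

theorem isCoalgHom_lift (X : C) :
    IsCoalgHom B (G.liftStr β X) (G.thetaNat.app (T.obj X)) ((G.lift β).app X) :=
  G.isCoalgHom_corec _ _

theorem lift_eps (X : C) :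
    (G.lift β).app X ≫ G.comonad.ε.app (T.obj X) = T.map (G.comonad.ε.app X) :=
  G.corec_eps _ _

/-- Naturality of `β` moves `ε` to the other side of `β`, where it cancels the `δ` in `liftStr` by
the counit law `B^∞ ε ∘ δ = id`. -/
theorem lift_pi (X : C) : (G.lift β).app X ≫ G.pi.app (T.obj X) = β.app X := by
  have h₁ : T.map (G.comonad.map (G.comonad.ε.app X)) ≫ β.app X =
    β.app (G.comonad.obj X) ≫ B.map (T.map (G.comonad.ε.app X)) := β.naturality _
  have h₂ : (G.lift β).app X ≫ G.thetaNat.app (T.obj X) =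
    G.liftStr β X ≫ B.map ((G.lift β).app X) := G.isCoalgHom_lift β X
  rw [← thetaNat_eps, ← Category.assoc, h₂, Category.assoc, ← B.map_comp, lift_eps, liftStr,
    Category.assoc, ← h₁, ← Category.assoc, ← T.map_comp, G.comonad.right_counit, T.map_id]
  exact Category.id_comp _

/-- Both sides are coalgebra morphisms from `liftStr` into a cofree coalgebra, so agreement after
`ε` suffices. On the right this uses that `T δ` is a coalgebra morphism, which is coassociativity.
-/
theorem lift_comul (X : C) :
    (G.lift β).app X ≫ G.comonad.δ.app (T.obj X) = T.map (G.comonad.δ.app X) ≫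
      (G.lift β).app (G.comonad.obj X) ≫ G.comonad.map ((G.lift β).app X) := by
  refine G.ext_of_isCoalgHom ((G.isCoalgHom_lift β X).comp (G.isCoalgHom_delta _))
    ((G.isCoalgHom_liftStr_delta β X).comp
      ((G.isCoalgHom_lift β _).comp (G.isCoalgHom_map _))) ?_
  have h₁ : G.comonad.map ((G.lift β).app X) ≫ G.comonad.ε.app (G.comonad.obj (T.obj X)) =
    G.comonad.ε.app (T.obj (G.comonad.obj X)) ≫ (G.lift β).app X := G.comonad.ε.naturality _
  have h₂ := G.lift_eps β (G.comonad.obj X)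
  simp only [Category.assoc]
  rw [G.comonad.left_counit, h₁, ← Category.assoc ((G.lift β).app _), h₂, ← Category.assoc,
    ← T.map_comp, G.comonad.left_counit, T.map_id]
  exact (Category.comp_id _).trans (Category.id_comp _).symm

/-- `β : T B^∞ ⟹ B T` extends coinductively to a distributive law as soon as it is compatible
with the unit and the multiplication of `T`. -/
noncomputable def liftLaw
    (hη : ∀ X, T.η.app (G.comonad.obj X) ≫ β.app X = G.pi.app X ≫ B.map (T.η.app X))
    (hμ : ∀ X, T.μ.app (G.comonad.obj X) ≫ β.app X =
      T.map ((G.lift β).app X) ≫ β.app (T.obj X) ≫ B.map (T.μ.app X)) :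
    DistributiveLaw T G.comonad where
  lam := G.lift β
  unit X := by
    have h : IsCoalgHom B (G.thetaNat.app X) (G.liftStr β X) (T.η.app (G.comonad.obj X)) := by
      have h₁ : G.comonad.δ.app X ≫ T.η.app (G.comonad.obj (G.comonad.obj X)) =
        T.η.app (G.comonad.obj X) ≫ T.map (G.comonad.δ.app X) := T.η.naturality _
      rw [IsCoalgHom, liftStr, ← Category.assoc, ← h₁, Category.assoc, hη, ← Category.assoc,
        delta_pi]
    refine G.ext_of_isCoalgHom (h.comp (G.isCoalgHom_lift β X)) (G.isCoalgHom_map _) ?_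
    have h₂ : G.comonad.ε.app X ≫ T.η.app X =
      T.η.app (G.comonad.obj X) ≫ T.map (G.comonad.ε.app X) := T.η.naturality _
    have h₃ : G.comonad.map (T.η.app X) ≫ G.comonad.ε.app (T.obj X) =
      G.comonad.ε.app X ≫ T.η.app X := G.comonad.ε.naturality _
    rw [Category.assoc, lift_eps, h₃, h₂]
  counit := G.lift_eps β
  mul X := by
    -- The structure on `T T B^∞ X` for which both `μ` and `T λ` are coalgebra morphisms: the former
    -- by `hμ`, the latter by `lift_comul` and naturality of `β`.
    let c : T.obj (T.obj (G.comonad.obj X)) ⟶ B.obj (T.obj (T.obj (G.comonad.obj X))) :=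
      T.map (T.map (G.comonad.δ.app X)) ≫ T.map ((G.lift β).app (G.comonad.obj X)) ≫
        β.app (T.obj (G.comonad.obj X))
    have h₁ : IsCoalgHom B c (G.liftStr β X) (T.μ.app (G.comonad.obj X)) := by
      have h : T.map (T.map (G.comonad.δ.app X)) ≫ T.μ.app (G.comonad.obj (G.comonad.obj X)) =
        T.μ.app (G.comonad.obj X) ≫ T.map (G.comonad.δ.app X) := T.μ.naturality _
      rw [IsCoalgHom, liftStr, ← Category.assoc, ← h, Category.assoc, hμ]
      simp only [c, Category.assoc]
    have h₂ : IsCoalgHom B c (G.liftStr β (T.obj X)) (T.map ((G.lift β).app X)) := by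
      have h : T.map (G.comonad.map ((G.lift β).app X)) ≫ β.app (G.comonad.obj (T.obj X)) =
        β.app (T.obj (G.comonad.obj X)) ≫ B.map (T.map ((G.lift β).app X)) := β.naturality _
      rw [IsCoalgHom, liftStr, ← Category.assoc, ← T.map_comp, lift_comul, T.map_comp,
        T.map_comp]
      simp only [c, Category.assoc]
      rw [h]
    refine G.ext_of_isCoalgHom (h₁.comp (G.isCoalgHom_lift β X))
      (h₂.comp ((G.isCoalgHom_lift β _).comp (G.isCoalgHom_map _))) ?_
    have h₃ : G.comonad.map (T.μ.app X) ≫ G.comonad.ε.app (T.obj X) =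
      G.comonad.ε.app (T.obj (T.obj X)) ≫ T.μ.app X := G.comonad.ε.naturality _
    have h₄ : T.map (T.map (G.comonad.ε.app X)) ≫ T.μ.app X =
      T.μ.app (G.comonad.obj X) ≫ T.map (G.comonad.ε.app X) := T.μ.naturality _
    have h₅ := G.lift_eps β (T.obj X)
    simp only [Category.assoc]
    rw [lift_eps, h₃, ← Category.assoc ((G.lift β).app _), h₅, ← Category.assoc, ← T.map_comp,
      lift_eps, h₄]
  comul := G.lift_comul β

end CofreeCoalgebras

/-- A distributive law over a cofree comonad is determined by its projection to `B`. -/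
theorem DistributiveLaw.ext_of_pi [HasBinaryProducts C] {B : C ⥤ C} {G : CofreeCoalgebras B}
    {T : Monad C} {l m : DistributiveLaw T G.comonad}
    (h : ∀ X, l.lam.app X ≫ G.pi.app (T.obj X) = m.lam.app X ≫ G.pi.app (T.obj X)) : l = m := by
  let p (n : DistributiveLaw T G.comonad) :
      G.comonad.toFunctor ⋙ T.toFunctor ⟶ T.toFunctor ⋙ B :=
    n.lam ≫ Functor.whiskerLeft T.toFunctor G.pi
  have key (n : DistributiveLaw T G.comonad) (X : C) :
      IsCoalgHom B (G.liftStr (p n) X) (G.thetaNat.app (T.obj X)) (n.lam.app X) := by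
    have h₁ : G.comonad.map (n.lam.app X) ≫ G.pi.app (G.comonad.obj (T.obj X)) =
      G.pi.app (T.obj (G.comonad.obj X)) ≫ B.map (n.lam.app X) := G.pi.naturality _
    rw [IsCoalgHom, ← G.delta_pi, ← Category.assoc, n.comul]
    simp only [Category.assoc]
    rw [h₁]
    simp [CofreeCoalgebras.liftStr, p]
  have hp : p l = p m := by
    ext X
    exact h X
  ext X : 3
  -- By `key`, both laws are coalgebra morphisms for structures built from their projections, and
  -- `hp` identifies those structures.
  refine G.ext_of_isCoalgHom (key l X) (hp ▸ key m X) ?_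
  exact (l.counit X).trans (m.counit X).symm

/-! ### The dual: inductive extension over a free monad -/

/-- `k` is a morphism of `S`-algebras from `g` to `h`. -/
def IsAlgHom (S : C ⥤ C) {X Y : C} (g : S.obj X ⟶ X) (h : S.obj Y ⟶ Y) (k : X ⟶ Y) : Prop :=
  g ≫ k = S.map k ≫ h

theorem IsAlgHom.comp {S : C ⥤ C} {X Y Z : C} {g : S.obj X ⟶ X} {h : S.obj Y ⟶ Y}
    {i : S.obj Z ⟶ Z} {k : X ⟶ Y} {l : Y ⟶ Z} (hk : IsAlgHom S g h k)
    (hl : IsAlgHom S h i l) : IsAlgHom S g i (k ≫ l) := by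
  unfold IsAlgHom at *
  rw [← Category.assoc, hk, Category.assoc, hl, S.map_comp, Category.assoc]

namespace FreeAlgebras

variable [HasBinaryCoproducts C] {S : C ⥤ C} (F : FreeAlgebras S)

/-- `ψ` as a natural transformation `S S* ⟹ S*`. -/
noncomputable def psiNat : F.monad.toFunctor ⋙ S ⟶ F.monad.toFunctor where
  app X := F.psi X
  naturality _ _ _ := (F.psi_fold _ _).symm

theorem isAlgHom_map {X Y : C} (f : X ⟶ Y) :
    IsAlgHom S (F.psiNat.app X) (F.psiNat.app Y) (F.monad.map f) :=
  (F.psiNat.naturality f).symm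

theorem isAlgHom_mu (X : C) :
    IsAlgHom S (F.psiNat.app (F.monad.obj X)) (F.psiNat.app X) (F.monad.μ.app X) :=
  F.psi_fold _ _

theorem eta_psiNat (X : C) :
    S.map (F.monad.η.app X) ≫ F.psiNat.app X = F.iota.app X := rfl

theorem iota_mu (X : C) :
    F.iota.app (F.monad.obj X) ≫ F.monad.μ.app X = F.psiNat.app X := by
  have h : F.psiNat.app (F.monad.obj X) ≫ F.monad.μ.app X =
    S.map (F.monad.μ.app X) ≫ F.psiNat.app X := F.isAlgHom_mu X
  have h' := F.monad.left_unit X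
  rw [← eta_psiNat, Category.assoc, h, ← Category.assoc, ← S.map_comp, h', S.map_id]
  exact Category.id_comp _

/-- The algebra morphism out of the free algebra on `X` induced by `f : X ⟶ Y`. -/
noncomputable def recurse {X Y : C} (g : S.obj Y ⟶ Y) (f : X ⟶ Y) : F.monad.obj X ⟶ Y :=
  F.fold g f

theorem isAlgHom_recurse {X Y : C} (g : S.obj Y ⟶ Y) (f : X ⟶ Y) :
    IsAlgHom S (F.psiNat.app X) g (F.recurse g f) :=
  F.psi_fold g f

theorem eta_recurse {X Y : C} (g : S.obj Y ⟶ Y) (f : X ⟶ Y) :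
    F.monad.η.app X ≫ F.recurse g f = f :=
  F.eta_fold g f

theorem ext_of_isAlgHom {X Y : C} {g : S.obj Y ⟶ Y} {k l : F.monad.obj X ⟶ Y}
    (hk : IsAlgHom S (F.psiNat.app X) g k) (hl : IsAlgHom S (F.psiNat.app X) g l)
    (h : F.monad.η.app X ≫ k = F.monad.η.app X ≫ l) : k = l :=
  F.hom_ext g hk hl h

variable {D : Comonad C} (κ : D.toFunctor ⋙ S ⟶ F.monad.toFunctor ⋙ D.toFunctor)

/-- The algebra structure on `D S* X` induced by `κ : S D ⟹ D S*`. -/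
noncomputable def liftStr (X : C) :
    S.obj (D.obj (F.monad.obj X)) ⟶ D.obj (F.monad.obj X) :=
  κ.app (F.monad.obj X) ≫ D.map (F.monad.μ.app X)

theorem isAlgHom_liftStr_map {X Y : C} (f : X ⟶ Y) :
    IsAlgHom S (F.liftStr κ X) (F.liftStr κ Y) (D.map (F.monad.map f)) := by
  have h₁ : S.map (D.map (F.monad.map f)) ≫ κ.app (F.monad.obj Y) =
    κ.app (F.monad.obj X) ≫ D.map (F.monad.map (F.monad.map f)) := κ.naturality _
  have h₂ : F.monad.map (F.monad.map f) ≫ F.monad.μ.app Y =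
    F.monad.μ.app X ≫ F.monad.map f := F.monad.μ.naturality f
  rw [IsAlgHom, liftStr, liftStr, Category.assoc, ← D.map_comp, ← h₂, D.map_comp,
    ← Category.assoc, ← h₁, Category.assoc]

theorem isAlgHom_liftStr_mu (X : C) :
    IsAlgHom S (F.liftStr κ (F.monad.obj X)) (F.liftStr κ X) (D.map (F.monad.μ.app X)) := by
  have h₁ : S.map (D.map (F.monad.μ.app X)) ≫ κ.app (F.monad.obj X) =
    κ.app (F.monad.obj (F.monad.obj X)) ≫ D.map (F.monad.map (F.monad.μ.app X)) :=
    κ.naturality _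
  rw [IsAlgHom, liftStr, liftStr, Category.assoc, ← D.map_comp, ← F.monad.assoc,
    D.map_comp, ← Category.assoc, ← h₁, Category.assoc]

/-- The transformation `S* D ⟹ D S*` inductively extending `κ : S D ⟹ D S*`. -/
noncomputable def lift :
    D.toFunctor ⋙ F.monad.toFunctor ⟶ F.monad.toFunctor ⋙ D.toFunctor where
  app X := F.recurse (F.liftStr κ X) (D.map (F.monad.η.app X))
  naturality X Y f := by
    refine F.ext_of_isAlgHom ((F.isAlgHom_map (D.map f)).comp (F.isAlgHom_recurse _ _))
      ((F.isAlgHom_recurse _ _).comp (F.isAlgHom_liftStr_map κ f)) ?_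
    have h₁ : D.map f ≫ F.monad.η.app (D.obj Y) =
      F.monad.η.app (D.obj X) ≫ F.monad.map (D.map f) := F.monad.η.naturality _
    have h₂ : f ≫ F.monad.η.app Y = F.monad.η.app X ≫ F.monad.map f :=
      F.monad.η.naturality f
    dsimp only [Functor.comp_map, Functor.comp_obj]
    rw [← Category.assoc, ← h₁, Category.assoc, eta_recurse, ← Category.assoc, eta_recurse,
      ← D.map_comp, h₂, D.map_comp]

theorem isAlgHom_lift (X : C) :
    IsAlgHom S (F.psiNat.app (D.obj X)) (F.liftStr κ X) ((F.lift κ).app X) :=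
  F.isAlgHom_recurse _ _

theorem eta_lift (X : C) :
    F.monad.η.app (D.obj X) ≫ (F.lift κ).app X = D.map (F.monad.η.app X) :=
  F.eta_recurse _ _

theorem iota_lift (X : C) : F.iota.app (D.obj X) ≫ (F.lift κ).app X = κ.app X := by
  have h₁ : S.map (D.map (F.monad.η.app X)) ≫ κ.app (F.monad.obj X) =
    κ.app X ≫ D.map (F.monad.map (F.monad.η.app X)) := κ.naturality _
  have h₂ : F.psiNat.app (D.obj X) ≫ (F.lift κ).app X =
    S.map ((F.lift κ).app X) ≫ F.liftStr κ X := F.isAlgHom_lift κ X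
  have h₃ : F.monad.map (F.monad.η.app X) ≫ F.monad.μ.app X = 𝟙 (F.monad.obj X) :=
    F.monad.right_unit X
  rw [← eta_psiNat, Category.assoc, h₂, ← Category.assoc, ← S.map_comp, eta_lift, liftStr,
    ← Category.assoc, h₁, Category.assoc, ← D.map_comp, h₃, D.map_id]
  exact Category.comp_id _

/-- Induction on terms: both sides are algebra morphisms out of a free algebra and agree on `η`.
Associativity of `μ` enters through `isAlgHom_liftStr_mu`. -/
theorem mu_lift (X : C) :
    F.monad.μ.app (D.obj X) ≫ (F.lift κ).app X = F.monad.map ((F.lift κ).app X) ≫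
      (F.lift κ).app (F.monad.obj X) ≫ D.map (F.monad.μ.app X) := by
  refine F.ext_of_isAlgHom ((F.isAlgHom_mu _).comp (F.isAlgHom_lift κ X))
    ((F.isAlgHom_map _).comp
      ((F.isAlgHom_lift κ _).comp (F.isAlgHom_liftStr_mu κ X))) ?_
  have h₁ : (F.lift κ).app X ≫ F.monad.η.app (D.obj (F.monad.obj X)) =
    F.monad.η.app (F.monad.obj (D.obj X)) ≫ F.monad.map ((F.lift κ).app X) :=
    F.monad.η.naturality _
  have h₂ := F.eta_lift κ (F.monad.obj X)
  rw [← Category.assoc, F.monad.left_unit, ← Category.assoc, ← h₁, Category.assoc,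
    ← Category.assoc (F.monad.η.app _), h₂, ← D.map_comp, F.monad.left_unit, D.map_id]
  exact (Category.id_comp _).trans (Category.comp_id _).symm

/-- `κ : S D ⟹ D S*` extends inductively to a distributive law as soon as it is compatible with
the counit and the comultiplication of `D`. -/
noncomputable def liftLaw
    (hε : ∀ X, κ.app X ≫ D.ε.app (F.monad.obj X) = S.map (D.ε.app X) ≫ F.iota.app X)
    (hδ : ∀ X, κ.app X ≫ D.δ.app (F.monad.obj X) =
      S.map (D.δ.app X) ≫ κ.app (D.obj X) ≫ D.map ((F.lift κ).app X)) :
    DistributiveLaw F.monad D where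
  lam := F.lift κ
  unit := F.eta_lift κ
  counit X := by
    have h : IsAlgHom S (F.liftStr κ X) (F.psiNat.app X) (D.ε.app (F.monad.obj X)) := by
      have h₁ : D.map (F.monad.μ.app X) ≫ D.ε.app (F.monad.obj X) =
        D.ε.app (F.monad.obj (F.monad.obj X)) ≫ F.monad.μ.app X := D.ε.naturality _
      rw [IsAlgHom, liftStr, Category.assoc, h₁, ← Category.assoc, hε, Category.assoc,
        iota_mu]
    refine F.ext_of_isAlgHom ((F.isAlgHom_lift κ X).comp h) (F.isAlgHom_map _) ?_
    have h₂ : D.map (F.monad.η.app X) ≫ D.ε.app (F.monad.obj X) =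
      D.ε.app X ≫ F.monad.η.app X := D.ε.naturality _
    have h₃ : D.ε.app X ≫ F.monad.η.app X =
      F.monad.η.app (D.obj X) ≫ F.monad.map (D.ε.app X) := F.monad.η.naturality _
    rw [← Category.assoc, eta_lift, h₂, h₃]
  mul := F.mu_lift κ
  comul X := by
    -- The structure on `D D S* X` for which both `δ` and `D λ` are algebra morphisms, by `hδ` and
    -- by `mu_lift` respectively.
    let c : S.obj (D.obj (D.obj (F.monad.obj X))) ⟶ D.obj (D.obj (F.monad.obj X)) :=
      κ.app (D.obj (F.monad.obj X)) ≫ D.map ((F.lift κ).app (F.monad.obj X)) ≫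
        D.map (D.map (F.monad.μ.app X))
    have h₁ : IsAlgHom S (F.liftStr κ X) c (D.δ.app (F.monad.obj X)) := by
      have h : D.map (F.monad.μ.app X) ≫ D.δ.app (F.monad.obj X) =
        D.δ.app (F.monad.obj (F.monad.obj X)) ≫ D.map (D.map (F.monad.μ.app X)) :=
        D.δ.naturality _
      rw [IsAlgHom, liftStr, Category.assoc, h, ← Category.assoc, hδ]
      simp only [c, Category.assoc]
    have h₂ : IsAlgHom S (F.liftStr κ (D.obj X)) c (D.map ((F.lift κ).app X)) := by
      have h : S.map (D.map ((F.lift κ).app X)) ≫ κ.app (D.obj (F.monad.obj X)) =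
        κ.app (F.monad.obj (D.obj X)) ≫ D.map (F.monad.map ((F.lift κ).app X)) :=
        κ.naturality _
      rw [IsAlgHom, liftStr, Category.assoc, ← D.map_comp, mu_lift, D.map_comp,
        D.map_comp, ← Category.assoc, ← h]
      simp only [c, Category.assoc]
    refine F.ext_of_isAlgHom ((F.isAlgHom_lift κ X).comp h₁)
      ((F.isAlgHom_map _).comp ((F.isAlgHom_lift κ _).comp h₂)) ?_
    have h₃ : D.δ.app X ≫ F.monad.η.app (D.obj (D.obj X)) =
      F.monad.η.app (D.obj X) ≫ F.monad.map (D.δ.app X) := F.monad.η.naturality _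
    have h₄ : D.map (F.monad.η.app X) ≫ D.δ.app (F.monad.obj X) =
      D.δ.app X ≫ D.map (D.map (F.monad.η.app X)) := D.δ.naturality _
    have h₅ := F.eta_lift κ (D.obj X)
    rw [← Category.assoc, eta_lift, h₄, ← Category.assoc, ← h₃, Category.assoc,
      ← Category.assoc (F.monad.η.app _), h₅, ← D.map_comp, eta_lift]

end FreeAlgebras

/-- A distributive law of a free monad is determined by its restriction to `S`. -/
theorem DistributiveLaw.ext_of_iota [HasBinaryCoproducts C] {S : C ⥤ C} {F : FreeAlgebras S}
    {D : Comonad C} {l m : DistributiveLaw F.monad D}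
    (h : ∀ X, F.iota.app (D.obj X) ≫ l.lam.app X = F.iota.app (D.obj X) ≫ m.lam.app X) :
    l = m := by
  let p (n : DistributiveLaw F.monad D) :
      D.toFunctor ⋙ S ⟶ F.monad.toFunctor ⋙ D.toFunctor :=
    Functor.whiskerLeft D.toFunctor F.iota ≫ n.lam
  have key (n : DistributiveLaw F.monad D) (X : C) :
      IsAlgHom S (F.psiNat.app (D.obj X)) (F.liftStr (p n) X) (n.lam.app X) := by
    have h₁ : S.map (n.lam.app X) ≫ F.iota.app (D.obj (F.monad.obj X)) =
      F.iota.app (F.monad.obj (D.obj X)) ≫ F.monad.map (n.lam.app X) := F.iota.naturality _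
    rw [IsAlgHom, ← F.iota_mu, Category.assoc, n.mul, ← Category.assoc, ← h₁]
    simp [FreeAlgebras.liftStr, p]
  have hp : p l = p m := by
    ext X
    exact h X
  ext X : 3
  refine F.ext_of_isAlgHom (key l X) (hp ▸ key m X) ?_
  exact (l.unit X).trans (m.unit X).symm

/-! ### Projections of `Id × B` and injections of `Id + S` -/

section

variable [HasBinaryProducts C] (B : C ⥤ C)

/-- The projection `Id × B ⟹ Id`. -/
noncomputable def idProdFst (X : C) : (idProd B).obj X ⟶ X :=
  prod.fst

/-- The projection `Id × B ⟹ B`. -/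
noncomputable def idProdSnd (X : C) : (idProd B).obj X ⟶ B.obj X :=
  prod.snd

theorem idProd_map_fst {X Y : C} (f : X ⟶ Y) :
    (idProd B).map f ≫ idProdFst B Y = idProdFst B X ≫ f :=
  prod.map_fst _ _

theorem idProd_map_snd {X Y : C} (f : X ⟶ Y) :
    (idProd B).map f ≫ idProdSnd B Y = idProdSnd B X ≫ B.map f :=
  prod.map_snd _ _

variable {B}

theorem idProd_hom_ext {X Y : C} {f g : Y ⟶ (idProd B).obj X}
    (h₁ : f ≫ idProdFst B X = g ≫ idProdFst B X)
    (h₂ : f ≫ idProdSnd B X = g ≫ idProdSnd B X) : f = g :=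
  Limits.prod.hom_ext h₁ h₂

variable (G : CofreeCoalgebras B)

theorem epsPi_fst (X : C) : (epsPi G).app X ≫ idProdFst B X = G.comonad.ε.app X :=
  prod.lift_fst _ _

theorem epsPi_snd (X : C) : (epsPi G).app X ≫ idProdSnd B X = G.pi.app X :=
  prod.lift_snd _ _

end

section

variable [HasBinaryCoproducts C] (S : C ⥤ C)

/-- The injection `Id ⟹ Id + S`. -/
noncomputable def idSumInl (X : C) : X ⟶ (idSum S).obj X :=
  coprod.inl

/-- The injection `S ⟹ Id + S`. -/
noncomputable def idSumInr (X : C) : S.obj X ⟶ (idSum S).obj X :=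
  coprod.inr

theorem inl_idSum_map {X Y : C} (f : X ⟶ Y) :
    idSumInl S X ≫ (idSum S).map f = f ≫ idSumInl S Y :=
  coprod.inl_map _ _

theorem inr_idSum_map {X Y : C} (f : X ⟶ Y) :
    idSumInr S X ≫ (idSum S).map f = S.map f ≫ idSumInr S Y :=
  coprod.inr_map _ _

variable {S}

theorem idSum_hom_ext {X Y : C} {f g : (idSum S).obj X ⟶ Y}
    (h₁ : idSumInl S X ≫ f = idSumInl S X ≫ g)
    (h₂ : idSumInr S X ≫ f = idSumInr S X ≫ g) : f = g :=
  coprod.hom_ext h₁ h₂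

variable (F : FreeAlgebras S)

theorem inl_etaIota (X : C) : idSumInl S X ≫ (etaIota F).app X = F.monad.η.app X :=
  coprod.inl_desc _ _

theorem inr_etaIota (X : C) : idSumInr S X ≫ (etaIota F).app X = F.iota.app X :=
  coprod.inr_desc _ _

end

variable [HasBinaryCoproducts C] [HasBinaryProducts C] {S B : C ⥤ C} {F : FreeAlgebras S}
  {G : CofreeCoalgebras B}

theorem DistributiveLaw.Extends.iota_lam_pi {ρ : BiGSOSLaw F G}
    {l : DistributiveLaw F.monad G.comonad} (h : l.Extends ρ) (X : C) :
    F.iota.app (G.comonad.obj X) ≫ l.lam.app X ≫ G.pi.app (F.monad.obj X) = ρ.app X :=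
  NatTrans.congr_app h X

/-! ### GSOS laws -/

namespace GSOSLaw

variable (ρ : GSOSLaw F B)

/-- The algebra structure on `S* X × B S* X` given by a GSOS law. -/
noncomputable def algStr (X : C) :
    S.obj ((idProd B).obj (F.monad.obj X)) ⟶ (idProd B).obj (F.monad.obj X) :=
  prod.lift (S.map (idProdFst B _) ≫ F.psiNat.app X)
    (ρ.app (F.monad.obj X) ≫ B.map (F.monad.μ.app X))

theorem algStr_fst (X : C) :
    ρ.algStr X ≫ idProdFst B _ = S.map (idProdFst B _) ≫ F.psiNat.app X :=
  prod.lift_fst _ _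

theorem algStr_snd (X : C) :
    ρ.algStr X ≫ idProdSnd B _ = ρ.app (F.monad.obj X) ≫ B.map (F.monad.μ.app X) :=
  prod.lift_snd _ _

/-- The first component needs `f` to respect `ψ`, the second needs it to respect `μ`. It is applied
to `f = S* g` and to `f = μ`. -/
theorem isAlgHom_idProd_map {X Y : C} (f : F.monad.obj X ⟶ F.monad.obj Y)
    (hf : IsAlgHom S (F.psiNat.app X) (F.psiNat.app Y) f)
    (hf' : F.monad.μ.app X ≫ f = F.monad.map f ≫ F.monad.μ.app Y) :
    IsAlgHom S (ρ.algStr X) (ρ.algStr Y) ((idProd B).map f) := by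
  have h : S.map ((idProd B).map f) ≫ ρ.app (F.monad.obj Y) =
    ρ.app (F.monad.obj X) ≫ B.map (F.monad.map f) := ρ.naturality f
  unfold IsAlgHom at hf ⊢
  apply idProd_hom_ext
  · rw [Category.assoc, idProd_map_fst, ← Category.assoc, algStr_fst, Category.assoc,
      Category.assoc, algStr_fst, hf, ← Category.assoc, ← Category.assoc, ← S.map_comp,
      ← S.map_comp, idProd_map_fst]
  · rw [Category.assoc, idProd_map_snd, ← Category.assoc, algStr_snd, Category.assoc,
      Category.assoc, algStr_snd, ← Category.assoc (S.map _), h, Category.assoc, ← B.map_comp,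
      ← B.map_comp, hf']

variable (G)

/-- The transformation `S* B^∞ ⟹ S* × B S*` defined by structural recursion from a GSOS law. -/
noncomputable def pairing :
    G.comonad.toFunctor ⋙ F.monad.toFunctor ⟶ F.monad.toFunctor ⋙ idProd B where
  app X := F.recurse (ρ.algStr X) ((epsPi G).app X ≫ (idProd B).map (F.monad.η.app X))
  naturality X Y f := by
    refine F.ext_of_isAlgHom ((F.isAlgHom_map _).comp (F.isAlgHom_recurse _ _))
      ((F.isAlgHom_recurse _ _).comp (ρ.isAlgHom_idProd_map (F.monad.map f)
        (F.isAlgHom_map f) (F.monad.μ.naturality f).symm)) ?_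
    have h₁ : G.comonad.map f ≫ F.monad.η.app (G.comonad.obj Y) =
      F.monad.η.app (G.comonad.obj X) ≫ F.monad.map (G.comonad.map f) :=
      F.monad.η.naturality _
    have h₂ : f ≫ F.monad.η.app Y = F.monad.η.app X ≫ F.monad.map f :=
      F.monad.η.naturality f
    have h₃ : G.comonad.map f ≫ (epsPi G).app Y = (epsPi G).app X ≫ (idProd B).map f :=
      (epsPi G).naturality f
    dsimp only [Functor.comp_map, Functor.comp_obj]
    rw [← Category.assoc, ← h₁, Category.assoc, F.eta_recurse, ← Category.assoc, h₃,
      ← Category.assoc, F.eta_recurse, Category.assoc, Category.assoc, ← Functor.map_comp,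
      ← Functor.map_comp, h₂]

theorem isAlgHom_pairing (X : C) :
    IsAlgHom S (F.psiNat.app (G.comonad.obj X)) (ρ.algStr X) ((ρ.pairing G).app X) :=
  F.isAlgHom_recurse _ _

theorem eta_pairing (X : C) :
    F.monad.η.app (G.comonad.obj X) ≫ (ρ.pairing G).app X =
      (epsPi G).app X ≫ (idProd B).map (F.monad.η.app X) :=
  F.eta_recurse _ _

/-- The first component of `algStr` ignores the `B`-part, so projecting the recursion leaves the one
that defines `S* ε`. -/
theorem pairing_fst (X : C) :
    (ρ.pairing G).app X ≫ idProdFst B _ = F.monad.map (G.comonad.ε.app X) := by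
  have h : IsAlgHom S (ρ.algStr X) (F.psiNat.app X) (idProdFst B _) := ρ.algStr_fst X
  refine F.ext_of_isAlgHom ((ρ.isAlgHom_pairing G X).comp h) (F.isAlgHom_map _) ?_
  have h₁ : G.comonad.ε.app X ≫ F.monad.η.app X =
    F.monad.η.app (G.comonad.obj X) ≫ F.monad.map (G.comonad.ε.app X) :=
    F.monad.η.naturality _
  rw [← Category.assoc, eta_pairing, Category.assoc, idProd_map_fst, ← Category.assoc,
    epsPi_fst, h₁]

/-- The component `S* B^∞ ⟹ B S*` of `pairing`. -/
noncomputable def step :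
    G.comonad.toFunctor ⋙ F.monad.toFunctor ⟶ F.monad.toFunctor ⋙ B where
  app X := (ρ.pairing G).app X ≫ idProdSnd B _
  naturality X Y f := by
    rw [← Category.assoc, (ρ.pairing G).naturality, Category.assoc, Functor.comp_map,
      idProd_map_snd, Category.assoc]
    rfl

theorem lift_epsPi (X : C) :
    (G.lift (ρ.step G)).app X ≫ (epsPi G).app (F.monad.obj X) = (ρ.pairing G).app X := by
  apply idProd_hom_ext
  · rw [Category.assoc, epsPi_fst, G.lift_eps, pairing_fst]
  · rw [Category.assoc, epsPi_snd, G.lift_pi]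
    rfl

/-- There is no circularity in `λ` occurring here: it is already defined from `step`. By induction
only the case of `η` remains, and that case is exactly `lift_epsPi`. -/
theorem mu_pairing (X : C) :
    F.monad.μ.app (G.comonad.obj X) ≫ (ρ.pairing G).app X =
      F.monad.map ((G.lift (ρ.step G)).app X) ≫ (ρ.pairing G).app (F.monad.obj X) ≫
        (idProd B).map (F.monad.μ.app X) := by
  refine F.ext_of_isAlgHom ((F.isAlgHom_mu _).comp (ρ.isAlgHom_pairing G X))
    ((F.isAlgHom_map _).comp ((ρ.isAlgHom_pairing G _).comp
      (ρ.isAlgHom_idProd_map _ (F.isAlgHom_mu X) (F.monad.assoc X).symm))) ?_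
  have h₁ : (G.lift (ρ.step G)).app X ≫ F.monad.η.app (G.comonad.obj (F.monad.obj X)) =
    F.monad.η.app (F.monad.obj (G.comonad.obj X)) ≫
      F.monad.map ((G.lift (ρ.step G)).app X) := F.monad.η.naturality _
  have h₂ := ρ.eta_pairing G (F.monad.obj X)
  have h₃ : F.monad.η.app (F.monad.obj X) ≫ F.monad.μ.app X = 𝟙 (F.monad.obj X) :=
    F.monad.left_unit X
  rw [← Category.assoc, F.monad.left_unit, ← Category.assoc, ← h₁, Category.assoc,
    ← Category.assoc (F.monad.η.app _), h₂, Category.assoc, ← Functor.map_comp,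
    h₃, CategoryTheory.Functor.map_id, ← lift_epsPi]
  exact (Category.id_comp _).trans (congrArg _ (Category.comp_id _).symm)

/-- The distributive law extending a GSOS law. -/
noncomputable def distributiveLaw : DistributiveLaw F.monad G.comonad :=
  G.liftLaw (ρ.step G)
    (fun X => by
      change _ ≫ (ρ.pairing G).app X ≫ idProdSnd B _ = _
      rw [← Category.assoc, eta_pairing, Category.assoc, idProd_map_snd, ← Category.assoc,
        epsPi_snd])
    (fun X => by
      change _ ≫ (ρ.pairing G).app X ≫ idProdSnd B _ =
        _ ≫ ((ρ.pairing G).app (F.monad.obj X) ≫ idProdSnd B _) ≫ _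
      rw [← Category.assoc, mu_pairing, Category.assoc, Category.assoc, Category.assoc,
        idProd_map_snd])

/-- Since `ι = ψ ∘ S η`, this is the `ψ`-clause of the recursion at depth one, where `μ ∘ S* η = id`
removes the extra layer. -/
theorem distributiveLaw_extends : (ρ.distributiveLaw G).Extends (ρ.toBiGSOS G) := by
  ext X
  change F.iota.app (G.comonad.obj X) ≫ (G.lift (ρ.step G)).app X ≫ G.pi.app (F.monad.obj X) =
    S.map ((epsPi G).app X) ≫ ρ.app X
  have h₁ : F.psiNat.app (G.comonad.obj X) ≫ (ρ.pairing G).app X =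
    S.map ((ρ.pairing G).app X) ≫ ρ.algStr X := ρ.isAlgHom_pairing G X
  have h₂ : S.map ((idProd B).map (F.monad.η.app X)) ≫ ρ.app (F.monad.obj X) =
    ρ.app X ≫ B.map (F.monad.map (F.monad.η.app X)) := ρ.naturality _
  have h₃ : F.monad.map (F.monad.η.app X) ≫ F.monad.μ.app X = 𝟙 (F.monad.obj X) :=
    F.monad.right_unit X
  rw [G.lift_pi]
  change F.iota.app (G.comonad.obj X) ≫ (ρ.pairing G).app X ≫ idProdSnd B _ = _
  rw [← F.eta_psiNat, Category.assoc, ← Category.assoc (F.psiNat.app _), h₁, Category.assoc,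
    algStr_snd, ← Category.assoc, ← S.map_comp, eta_pairing, S.map_comp, Category.assoc,
    ← Category.assoc (S.map ((idProd B).map _)), h₂, Category.assoc, ← B.map_comp, h₃,
    B.map_id]
  exact congrArg _ (Category.comp_id _)

variable {G}

theorem lam_epsPi_of_extends {l : DistributiveLaw F.monad G.comonad}
    (hl : l.Extends (ρ.toBiGSOS G)) (X : C) :
    l.lam.app X ≫ (epsPi G).app (F.monad.obj X) = (ρ.pairing G).app X := by
  have hε : l.lam.app X ≫ G.comonad.ε.app (F.monad.obj X) =
    F.monad.map (G.comonad.ε.app X) := l.counit X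
  have hη : F.monad.η.app (G.comonad.obj X) ≫ l.lam.app X =
    G.comonad.map (F.monad.η.app X) := l.unit X
  have h : IsAlgHom S (F.psiNat.app (G.comonad.obj X)) (ρ.algStr X)
      (l.lam.app X ≫ (epsPi G).app (F.monad.obj X)) := by
    unfold IsAlgHom
    apply idProd_hom_ext
    · have h₁ : F.psiNat.app (G.comonad.obj X) ≫ F.monad.map (G.comonad.ε.app X) =
        S.map (F.monad.map (G.comonad.ε.app X)) ≫ F.psiNat.app X := F.isAlgHom_map _
      simp only [Category.assoc]
      rw [epsPi_fst, algStr_fst, hε, h₁, ← Category.assoc, ← S.map_comp, Category.assoc,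
        epsPi_fst, hε]
    · have h₁ : S.map (l.lam.app X) ≫ F.iota.app (G.comonad.obj (F.monad.obj X)) =
        F.iota.app (F.monad.obj (G.comonad.obj X)) ≫ F.monad.map (l.lam.app X) :=
        F.iota.naturality _
      have h₂ : G.comonad.map (F.monad.μ.app X) ≫ G.pi.app (F.monad.obj X) =
        G.pi.app (F.monad.obj (F.monad.obj X)) ≫ B.map (F.monad.μ.app X) := G.pi.naturality _
      have h₃ : F.iota.app (G.comonad.obj (F.monad.obj X)) ≫ l.lam.app (F.monad.obj X) ≫
        G.pi.app (F.monad.obj (F.monad.obj X)) =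
          S.map ((epsPi G).app (F.monad.obj X)) ≫ ρ.app (F.monad.obj X) :=
        hl.iota_lam_pi (F.monad.obj X)
      have h₄ : F.monad.μ.app (G.comonad.obj X) ≫ l.lam.app X =
        F.monad.map (l.lam.app X) ≫ l.lam.app (F.monad.obj X) ≫
          G.comonad.map (F.monad.μ.app X) := l.mul X
      -- As `ψ = μ ∘ ι`, the multiplication axiom turns `λ ∘ ψ` into an instance of `λ ∘ ι` at `S*
      -- X`, to which the extension hypothesis `h₃` applies after `π`.
      have h₅ : F.psiNat.app (G.comonad.obj X) ≫ l.lam.app X =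
          S.map (l.lam.app X) ≫ F.iota.app (G.comonad.obj (F.monad.obj X)) ≫
            l.lam.app (F.monad.obj X) ≫ G.comonad.map (F.monad.μ.app X) := by
        rw [← F.iota_mu, Category.assoc, h₄, ← Category.assoc, ← h₁, Category.assoc]
      simp only [Category.assoc]
      rw [epsPi_snd, algStr_snd, ← Category.assoc, h₅, S.map_comp,
        Category.assoc (S.map (l.lam.app X)) (S.map ((epsPi G).app _)),
        ← Category.assoc (S.map ((epsPi G).app _)), ← h₃]
      simp only [Category.assoc]
      rw [h₂]
  refine F.ext_of_isAlgHom h (ρ.isAlgHom_pairing G X) ?_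
  have h₁ : G.comonad.map (F.monad.η.app X) ≫ (epsPi G).app (F.monad.obj X) =
    (epsPi G).app X ≫ (idProd B).map (F.monad.η.app X) := (epsPi G).naturality _
  rw [← Category.assoc, hη, h₁, eta_pairing]

variable (G)

/-- A GSOS law extends uniquely to a distributive law. -/
theorem existsUnique_extends :
    ∃! l : DistributiveLaw F.monad G.comonad, l.Extends (ρ.toBiGSOS G) := by
  refine ⟨ρ.distributiveLaw G, ρ.distributiveLaw_extends G, fun l hl =>
    DistributiveLaw.ext_of_pi fun X => ?_⟩
  rw [← epsPi_snd, ← Category.assoc, ← Category.assoc, ρ.lam_epsPi_of_extends hl,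
    ρ.lam_epsPi_of_extends (ρ.distributiveLaw_extends G)]

end GSOSLaw

/-! ### CoGSOS laws, dually -/

namespace CoGSOSLaw

variable (ρ : CoGSOSLaw S G)

/-- The coalgebra structure on `B^∞ X + S B^∞ X` given by a coGSOS law. -/
noncomputable def coalgStr (X : C) :
    (idSum S).obj (G.comonad.obj X) ⟶ B.obj ((idSum S).obj (G.comonad.obj X)) :=
  coprod.desc (G.thetaNat.app X ≫ B.map (idSumInl S _))
    (S.map (G.comonad.δ.app X) ≫ ρ.app (G.comonad.obj X))

theorem inl_coalgStr (X : C) :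
    idSumInl S _ ≫ ρ.coalgStr X = G.thetaNat.app X ≫ B.map (idSumInl S _) :=
  coprod.inl_desc _ _

theorem inr_coalgStr (X : C) :
    idSumInr S _ ≫ ρ.coalgStr X = S.map (G.comonad.δ.app X) ≫ ρ.app (G.comonad.obj X) :=
  coprod.inr_desc _ _

theorem isCoalgHom_idSum_map {X Y : C} (f : G.comonad.obj X ⟶ G.comonad.obj Y)
    (hf : IsCoalgHom B (G.thetaNat.app X) (G.thetaNat.app Y) f)
    (hf' : f ≫ G.comonad.δ.app Y = G.comonad.δ.app X ≫ G.comonad.map f) :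
    IsCoalgHom B (ρ.coalgStr X) (ρ.coalgStr Y) ((idSum S).map f) := by
  have h : S.map (G.comonad.map f) ≫ ρ.app (G.comonad.obj Y) =
    ρ.app (G.comonad.obj X) ≫ B.map ((idSum S).map f) := ρ.naturality f
  unfold IsCoalgHom at hf ⊢
  apply idSum_hom_ext
  · rw [← Category.assoc, inl_idSum_map, Category.assoc, inl_coalgStr, ← Category.assoc, hf,
      ← Category.assoc, inl_coalgStr, Category.assoc, Category.assoc, ← B.map_comp,
      ← B.map_comp, inl_idSum_map]
  · rw [← Category.assoc, inr_idSum_map, Category.assoc, inr_coalgStr, ← Category.assoc,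
      ← Category.assoc, inr_coalgStr, ← S.map_comp, hf', S.map_comp, Category.assoc, h,
      Category.assoc]

variable (F)

/-- The transformation `B^∞ + S B^∞ ⟹ B^∞ S*` defined by corecursion from a coGSOS law. -/
noncomputable def copairing :
    G.comonad.toFunctor ⋙ idSum S ⟶ F.monad.toFunctor ⋙ G.comonad.toFunctor where
  app X := G.corec (ρ.coalgStr X) ((idSum S).map (G.comonad.ε.app X) ≫ (etaIota F).app X)
  naturality X Y f := by
    refine G.ext_of_isCoalgHom ((ρ.isCoalgHom_idSum_map (G.comonad.map f)
        (G.isCoalgHom_map f) (G.comonad.δ.naturality f)).comp (G.isCoalgHom_corec _ _))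
      ((G.isCoalgHom_corec _ _).comp (G.isCoalgHom_map _)) ?_
    have h₁ : G.comonad.map (F.monad.map f) ≫ G.comonad.ε.app (F.monad.obj Y) =
      G.comonad.ε.app (F.monad.obj X) ≫ F.monad.map f := G.comonad.ε.naturality _
    have h₂ : G.comonad.map f ≫ G.comonad.ε.app Y = G.comonad.ε.app X ≫ f :=
      G.comonad.ε.naturality f
    have h₃ : (idSum S).map f ≫ (etaIota F).app Y = (etaIota F).app X ≫ F.monad.map f :=
      (etaIota F).naturality f
    dsimp only [Functor.comp_map, Functor.comp_obj]
    rw [Category.assoc, G.corec_eps, Category.assoc, h₁, ← Category.assoc, ← Category.assoc,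
      G.corec_eps, Category.assoc ((idSum S).map (G.comonad.ε.app X)), ← h₃,
      ← Functor.map_comp, h₂, Functor.map_comp, Category.assoc]

theorem isCoalgHom_copairing (X : C) :
    IsCoalgHom B (ρ.coalgStr X) (G.thetaNat.app (F.monad.obj X)) ((ρ.copairing F).app X) :=
  G.isCoalgHom_corec _ _

theorem copairing_eps (X : C) :
    (ρ.copairing F).app X ≫ G.comonad.ε.app (F.monad.obj X) =
      (idSum S).map (G.comonad.ε.app X) ≫ (etaIota F).app X :=
  G.corec_eps _ _

/-- On the left summand `coalgStr` is just `θ`, so the corecursion restricts to the one that defines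
`B^∞ η`. -/
theorem inl_copairing (X : C) :
    idSumInl S _ ≫ (ρ.copairing F).app X = G.comonad.map (F.monad.η.app X) := by
  have h : IsCoalgHom B (G.thetaNat.app X) (ρ.coalgStr X) (idSumInl S _) := ρ.inl_coalgStr X
  refine G.ext_of_isCoalgHom (h.comp (ρ.isCoalgHom_copairing F X)) (G.isCoalgHom_map _) ?_
  have h₁ : G.comonad.map (F.monad.η.app X) ≫ G.comonad.ε.app (F.monad.obj X) =
    G.comonad.ε.app X ≫ F.monad.η.app X := G.comonad.ε.naturality _
  rw [Category.assoc, copairing_eps, ← Category.assoc, inl_idSum_map, Category.assoc, h₁]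
  exact congrArg _ (inl_etaIota F X)

/-- The component `S B^∞ ⟹ B^∞ S*` of `copairing`. -/
noncomputable def step :
    G.comonad.toFunctor ⋙ S ⟶ F.monad.toFunctor ⋙ G.comonad.toFunctor where
  app X := idSumInr S _ ≫ (ρ.copairing F).app X
  naturality X Y f := by
    rw [Category.assoc, ← (ρ.copairing F).naturality, ← Category.assoc, ← Category.assoc,
      Functor.comp_map, Functor.comp_map, inr_idSum_map]

theorem etaIota_lift (X : C) :
    (etaIota F).app (G.comonad.obj X) ≫ (F.lift (ρ.step F)).app X =
      (ρ.copairing F).app X := by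
  apply idSum_hom_ext
  · rw [← Category.assoc, inl_etaIota, F.eta_lift, inl_copairing]
  · rw [← Category.assoc, inr_etaIota, F.iota_lift]
    rfl

/-- By coinduction only the comparison after `ε` remains, and that comparison is `etaIota_lift`. The
right summand yields the hypothesis `hδ` of `FreeAlgebras.liftLaw`. -/
theorem copairing_delta (X : C) :
    (ρ.copairing F).app X ≫ G.comonad.δ.app (F.monad.obj X) =
      (idSum S).map (G.comonad.δ.app X) ≫ (ρ.copairing F).app (G.comonad.obj X) ≫
        G.comonad.map ((F.lift (ρ.step F)).app X) := by
  refine G.ext_of_isCoalgHom ((ρ.isCoalgHom_copairing F X).comp (G.isCoalgHom_delta _))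
    ((ρ.isCoalgHom_idSum_map _ (G.isCoalgHom_delta X) (G.comonad.coassoc X).symm).comp
      ((ρ.isCoalgHom_copairing F _).comp (G.isCoalgHom_map _))) ?_
  have h₁ : G.comonad.map ((F.lift (ρ.step F)).app X) ≫
      G.comonad.ε.app (G.comonad.obj (F.monad.obj X)) =
    G.comonad.ε.app (F.monad.obj (G.comonad.obj X)) ≫ (F.lift (ρ.step F)).app X :=
    G.comonad.ε.naturality _
  have h₂ := ρ.copairing_eps F (G.comonad.obj X)
  have h₃ : G.comonad.δ.app X ≫ G.comonad.ε.app (G.comonad.obj X) = 𝟙 (G.comonad.obj X) :=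
    G.comonad.left_counit X
  simp only [Category.assoc]
  rw [G.comonad.left_counit, h₁, ← Category.assoc ((ρ.copairing F).app (G.comonad.obj X)), h₂,
    Category.assoc, etaIota_lift, ← Category.assoc, ← Functor.map_comp, h₃, CategoryTheory.Functor.map_id]
  exact (Category.comp_id _).trans (Category.id_comp _).symm

/-- The distributive law extending a coGSOS law. -/
noncomputable def distributiveLaw : DistributiveLaw F.monad G.comonad :=
  F.liftLaw (ρ.step F)
    (fun X => by
      change (idSumInr S _ ≫ (ρ.copairing F).app X) ≫ _ = _
      rw [Category.assoc, copairing_eps, ← Category.assoc, inr_idSum_map, Category.assoc]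
      exact congrArg _ (inr_etaIota F X))
    (fun X => by
      change (idSumInr S _ ≫ (ρ.copairing F).app X) ≫ _ =
        _ ≫ (idSumInr S _ ≫ (ρ.copairing F).app (G.comonad.obj X)) ≫ _
      rw [Category.assoc, copairing_delta, ← Category.assoc, inr_idSum_map]
      simp only [Category.assoc]
      rfl)

theorem distributiveLaw_extends : (ρ.distributiveLaw F).Extends (ρ.toBiGSOS F) := by
  ext X
  change F.iota.app (G.comonad.obj X) ≫ (F.lift (ρ.step F)).app X ≫ G.pi.app (F.monad.obj X) =
    ρ.app X ≫ B.map ((etaIota F).app X)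
  have h₁ : (ρ.copairing F).app X ≫ G.thetaNat.app (F.monad.obj X) =
    ρ.coalgStr X ≫ B.map ((ρ.copairing F).app X) := ρ.isCoalgHom_copairing F X
  have h₂ : S.map (G.comonad.map (G.comonad.ε.app X)) ≫ ρ.app X =
    ρ.app (G.comonad.obj X) ≫ B.map ((idSum S).map (G.comonad.ε.app X)) := ρ.naturality _
  have h₃ : G.comonad.δ.app X ≫ G.comonad.map (G.comonad.ε.app X) = 𝟙 (G.comonad.obj X) :=
    G.comonad.right_counit X
  rw [← Category.assoc, F.iota_lift]
  change (idSumInr S _ ≫ (ρ.copairing F).app X) ≫ _ = _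
  rw [← G.thetaNat_eps, Category.assoc, ← Category.assoc ((ρ.copairing F).app X), h₁,
    Category.assoc, ← B.map_comp, copairing_eps, ← Category.assoc, inr_coalgStr, B.map_comp,
    Category.assoc, ← Category.assoc (ρ.app (G.comonad.obj X)), ← h₂, ← Category.assoc,
    ← Category.assoc, ← S.map_comp, h₃, S.map_id]
  exact congrArg (· ≫ B.map ((etaIota F).app X)) (Category.id_comp (ρ.app X))

variable {F}

theorem etaIota_lam_of_extends {l : DistributiveLaw F.monad G.comonad}
    (hl : l.Extends (ρ.toBiGSOS F)) (X : C) :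
    (etaIota F).app (G.comonad.obj X) ≫ l.lam.app X = (ρ.copairing F).app X := by
  have hε : l.lam.app X ≫ G.comonad.ε.app (F.monad.obj X) =
    F.monad.map (G.comonad.ε.app X) := l.counit X
  have hη : F.monad.η.app (G.comonad.obj X) ≫ l.lam.app X =
    G.comonad.map (F.monad.η.app X) := l.unit X
  have h : IsCoalgHom B (ρ.coalgStr X) (G.thetaNat.app (F.monad.obj X))
      ((etaIota F).app (G.comonad.obj X) ≫ l.lam.app X) := by
    unfold IsCoalgHom
    apply idSum_hom_ext
    · have h₁ : G.comonad.map (F.monad.η.app X) ≫ G.thetaNat.app (F.monad.obj X) =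
        G.thetaNat.app X ≫ B.map (G.comonad.map (F.monad.η.app X)) := G.isCoalgHom_map _
      simp only [← Category.assoc]
      rw [inl_etaIota, inl_coalgStr, hη, h₁, Category.assoc, ← B.map_comp, ← Category.assoc,
        inl_etaIota, hη]
    · have h₁ : G.comonad.map (l.lam.app X) ≫ G.pi.app (G.comonad.obj (F.monad.obj X)) =
        G.pi.app (F.monad.obj (G.comonad.obj X)) ≫ B.map (l.lam.app X) := G.pi.naturality _
      have h₂ : S.map (G.comonad.δ.app X) ≫ F.iota.app (G.comonad.obj (G.comonad.obj X)) =
        F.iota.app (G.comonad.obj X) ≫ F.monad.map (G.comonad.δ.app X) := F.iota.naturality _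
      have h₃ : F.iota.app (G.comonad.obj (G.comonad.obj X)) ≫
        l.lam.app (G.comonad.obj X) ≫ G.pi.app (F.monad.obj (G.comonad.obj X)) =
          ρ.app (G.comonad.obj X) ≫ B.map ((etaIota F).app (G.comonad.obj X)) :=
        hl.iota_lam_pi (G.comonad.obj X)
      have h₄ : l.lam.app X ≫ G.comonad.δ.app (F.monad.obj X) =
        F.monad.map (G.comonad.δ.app X) ≫ l.lam.app (G.comonad.obj X) ≫
          G.comonad.map (l.lam.app X) := l.comul X
      -- As `θ = π ∘ δ`, the comultiplication axiom turns `θ ∘ λ` into an instance of `π ∘ λ` at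
      -- `B^∞ X`, to which the extension hypothesis `h₃` applies after precomposing with `ι`.
      have h₅ : l.lam.app X ≫ G.thetaNat.app (F.monad.obj X) =
          F.monad.map (G.comonad.δ.app X) ≫ (l.lam.app (G.comonad.obj X) ≫
            G.pi.app (F.monad.obj (G.comonad.obj X))) ≫ B.map (l.lam.app X) := by
        rw [← G.delta_pi, ← Category.assoc, h₄]
        simp only [Category.assoc]
        rw [h₁]
      simp only [← Category.assoc]
      rw [inr_etaIota, inr_coalgStr, Category.assoc, h₅, ← Category.assoc, ← h₂,
        Category.assoc, ← Category.assoc (F.iota.app _), h₃, B.map_comp]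
      simp only [Category.assoc]
  refine G.ext_of_isCoalgHom h (ρ.isCoalgHom_copairing F X) ?_
  have h₁ : (idSum S).map (G.comonad.ε.app X) ≫ (etaIota F).app X =
    (etaIota F).app (G.comonad.obj X) ≫ F.monad.map (G.comonad.ε.app X) :=
    (etaIota F).naturality _
  rw [Category.assoc, hε, ← h₁, copairing_eps]

variable (F)

/-- A coGSOS law extends uniquely to a distributive law. -/
theorem existsUnique_extends :
    ∃! l : DistributiveLaw F.monad G.comonad, l.Extends (ρ.toBiGSOS F) := by
  refine ⟨ρ.distributiveLaw F, ρ.distributiveLaw_extends F, fun l hl =>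
    DistributiveLaw.ext_of_iota fun X => ?_⟩
  rw [← inr_etaIota, Category.assoc, Category.assoc, ρ.etaIota_lam_of_extends hl,
    ρ.etaIota_lam_of_extends (ρ.distributiveLaw_extends F)]

end CoGSOSLaw

end Klin

theorem theorem3p4 (S B : Type w ⥤ Type w)
    (F : Klin.FreeAlgebras S) (G : Klin.CofreeCoalgebras B) :
    (∀ ρ : Klin.GSOSLaw F B,
      ∃! l : Klin.DistributiveLaw F.monad G.comonad, l.Extends (Klin.GSOSLaw.toBiGSOS ρ G)) ∧
    (∀ ρ : Klin.CoGSOSLaw S G,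
      ∃! l : Klin.DistributiveLaw F.monad G.comonad, l.Extends (Klin.CoGSOSLaw.toBiGSOS ρ F)) :=
  ⟨fun ρ => ρ.existsUnique_extends G, fun ρ => ρ.existsUnique_extends F⟩
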